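/- For $m\ge 1$, $\theta\in(0,1)$ and $\rho>0$, call a unit vector $u\in\mathbb C^m$ *$(\theta,\rho)$-compressible* if there is a set $J\subset[m]$ with $|J|=\lfloor\theta m\rfloor$ such that $u$ lies within Euclidean distance at most $\rho$ of the coordinate subspace $\mathbb C^J$ of vectors supported on $J$, and *$(\theta,\rho)$-incompressible* otherwise. **Lemma 5.2 (Distance of a random vector to an incompressible subspace).** There are absolute constants $c,C>0$ such that the following holds. Let $\varepsilon\in(0,1)$ and let $\xi$ be a centered complex-valued random variable with unit variance, $\mathbb E|\xi|^2=1$. There is a constant $K>0$ depending only on $\varepsilon$ and on the distribution of $\xi$ such that for all integers $n,k$ the following is true. Let $X=(\xi_1,\dots,\xi_n)$ be a vector of iid copies of $\xi$, let $\sigma=(\sigma_1,\dots,\sigma_n)\in[0,1]^n$, and put $R=\sigma\circ X=(\sigma_j\xi_j)_{j=1}^n$. Let $\delta,\sigma_0\in(0,1)$ be such that $|\{j\in[n]:\sigma_j\ge\sigma_0\}|\ge\delta n$. Let $V\subset\mathbb C^n$ be a (complex) subspace of dimension $n-k$, and let $\rho>0$ be such that every unit vector $u\in V^\perp$ is $(1-\frac\delta2,\rho)$-incompressible.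 If $$\frac{C\,n^{\varepsilon}}{\sigma_0^2\rho^2\delta}\le k\le n-1,$$ then for every fixed $v\in\mathbb C^n$, $$\mathbb P\Big(\operatorname{dist}(R+v,V)\le c\,\sigma_0\,\rho\sqrt{\delta k}\Big)\le K\exp\Big(-\frac{c\,\sigma_0^2\rho^2\delta k}{n^{\varepsilon}}\Big),$$ where $\operatorname{dist}$ is the Euclidean distance. -/

import Mathlib

open MeasureTheory ProbabilityTheory

/-- The coordinate subspace `ℂ^J` of `ℂ^m`: the vectors supported on `J`. -/
def coordSubspace {m : ℕ} (J : Finset (Fin m)) : Submodule ℂ (EuclideanSpace ℂ (Fin m)) where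
  carrier := {x | ∀ i, i ∉ J → x i = 0}
  add_mem' := by
    intro x y hx hy i hi
    simp [hx i hi, hy i hi]
  zero_mem' := by
    intro i _
    simp
  smul_mem' := by
    intro a x hx i hi
    simp [hx i hi]

/-- The `(θ, ρ)`-compressible vectors of `ℂ^m`: the unit vectors lying in the closed Euclidean
`ρ`-neighbourhood of `ℂ^J` for some set `J` of `⌊θ m⌋` coordinates. -/
def Compr (m : ℕ) (θ ρ : ℝ) : Set (EuclideanSpace ℂ (Fin m)) :=
  Metric.sphere 0 1 ∩
    ⋃ J ∈ {J : Finset (Fin m) | J.card = ⌊θ * m⌋₊},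
      Metric.cthickening ρ (coordSubspace J : Set (EuclideanSpace ℂ (Fin m)))

/-- The `(θ, ρ)`-incompressible vectors of `ℂ^m`: the unit vectors that are not compressible. -/
def Incompr (m : ℕ) (θ ρ : ℝ) : Set (EuclideanSpace ℂ (Fin m)) :=
  Metric.sphere 0 1 \ Compr m θ ρ

/-- The weighted vector `X ∘ σ = (σ_j x_j)_j`, as an element of Euclidean space `ℂ^n`. -/
def weightedVec {n : ℕ} (σ : Fin n → ℝ) (x : Fin n → ℂ) : EuclideanSpace ℂ (Fin n) :=
  WithLp.toLp 2 (fun j => (σ j : ℂ) * x j)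

/-! The distance to `V` is at least the norm of `a + ∑ x_j q_j`, where `q_j` is `σ_j` times the
projection of the basis vector `e_j` to `Vᗮ`, and `a` is the projection of `v`. By Markov, its lower
tail follows from `E exp(-‖a + ∑ x_j q_j‖² / τ) ≤ exp(-∑ ‖q_j‖² / (32τ))`, a case of
`lintegral_pi_quadWeight_le`.

That bound integrates out one coordinate at a time, carrying the weight `exp(-⟨T⁻¹ y, y⟩)`, with `T
= τ` at the start. With probability at least 1/2 a coordinate falls in a ball of radius `M`, where
its conditional variance is at least 1/2; averaging there gains a factor `exp(-‖q‖² / (8τ))` and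
replaces `T` by `T + τ q q*`. Outside the ball the coordinate is frozen into the shift. As `∑ q_j
q_j* ≤ 1`, `T` stays below `2τ`, so the gain does not degrade.

Incompressibility of an orthonormal basis of `Vᗮ` gives `∑ ‖q_j‖² ≥ σ₀² k ρ²`. The choice `τ = 128
n^ε` exceeds `128 M²` for large `n`; the constant `K` covers small `n`. -/

/-! ### One bounded variable. -/

/-- One-dimensional Laplace transform bound for a bounded complex random variable. -/
theorem lintegral_exp_quadratic_le {ν : Measure ℂ} [IsProbabilityMeasure ν] {B α τ : ℝ} {m : ℂ}
    (hα : 0 ≤ α) (hατ : α * τ ≤ 1) (hBτ : 32 * B ^ 2 ≤ τ)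
    (hτ : 0 < τ) (hbd : ∀ᵐ x ∂ν, ‖x - m‖ ≤ B) (hmean : ∫ x, (x - m) ∂ν = 0) (β : ℂ) :
    ∫⁻ x, ENNReal.ofReal (Real.exp (-(2 * ((x - m) * β).re + α * ‖x - m‖ ^ 2))) ∂ν ≤
      ENNReal.ofReal (Real.exp (-(α * (∫ x, ‖x - m‖ ^ 2 ∂ν) / 2) + τ / 2 * ‖β‖ ^ 2)) := by
  have hαB : α * B ^ 2 ≤ 1 / 32 := by nlinarith
  have hint1 : Integrable (fun x : ℂ => x - m) ν :=
    Integrable.of_bound (by fun_prop) B hbd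
  have hint2 : Integrable (fun x : ℂ => ‖x - m‖ ^ 2) ν :=
    Integrable.of_bound (by fun_prop) (B ^ 2) (hbd.mono fun x hx => by
      rw [Real.norm_of_nonneg (by positivity)]; gcongr)
  set s := ∫ x, ‖x - m‖ ^ 2 ∂ν with hs
  have hs0 : 0 ≤ s := integral_nonneg fun x => by positivity
  have hsB : s ≤ B ^ 2 := by
    have := integral_mono_ae hint2 (integrable_const (B ^ 2)) (hbd.mono fun x hx => by
      show ‖x - m‖ ^ 2 ≤ B ^ 2; gcongr)
    simpa using this
  have hre : ∀ y : ℂ, |(y * β).re| ≤ ‖y‖ * ‖β‖ := fun y => by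
    simpa using Complex.abs_re_le_norm (y * β)
  -- For small `β`, use `exp z ≤ 1 + z + z²`: centring kills the linear term and the square costs at
  -- most `8‖β‖²s`. For large `β`, the allowance `τ/2 ‖β‖²` exceeds the exponent pointwise.
  by_cases hb : ‖β‖ * B ≤ 1 / 4
  · have hint3 : Integrable (fun x : ℂ => ((x - m) * β).re) ν := (hint1.mul_const β).re
    have hmean3 : ∫ x : ℂ, ((x - m) * β).re ∂ν = 0 := by
      have h1 := integral_re (hint1.mul_const β)
      rw [integral_mul_const, hmean] at h1
      simpa using h1
    have hpt : ∀ᵐ x ∂ν, ENNReal.ofReal (Real.exp (-(2 * ((x - m) * β).re + α * ‖x - m‖ ^ 2))) ≤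
        ENNReal.ofReal (1 - 2 * ((x - m) * β).re + (8 * ‖β‖ ^ 2 - α / 2) * ‖x - m‖ ^ 2) := by
      filter_upwards [hbd] with x hx
      apply ENNReal.ofReal_le_ofReal
      set y := x - m
      set r := (y * β).re
      have hr : |r| ≤ ‖y‖ * ‖β‖ := hre y
      have hr4 : |r| ≤ 1 / 4 := hr.trans (by nlinarith [norm_nonneg β, norm_nonneg y])
      have hy2 : ‖y‖ ^ 2 ≤ B ^ 2 := by gcongr
      have hay : α * ‖y‖ ^ 2 ≤ 1 / 32 := by nlinarith
      have hay0 : 0 ≤ α * ‖y‖ ^ 2 := by positivity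
      have hz : |-(2 * r + α * ‖y‖ ^ 2)| ≤ 1 := by
        rw [abs_le] at hr4 ⊢; constructor <;> linarith
      have he := (abs_le.1 (Real.abs_exp_sub_one_sub_id_le hz)).2
      have hr2 : r ^ 2 ≤ ‖y‖ ^ 2 * ‖β‖ ^ 2 := by
        rw [← mul_pow, ← sq_abs r]; gcongr
      have hq : (α * ‖y‖ ^ 2) ^ 2 ≤ α * ‖y‖ ^ 2 / 32 := by nlinarith
      nlinarith [sq_nonneg (2 * r - α * ‖y‖ ^ 2)]
    have hnn : 0 ≤ᵐ[ν] fun x : ℂ =>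
        1 - 2 * ((x - m) * β).re + (8 * ‖β‖ ^ 2 - α / 2) * ‖x - m‖ ^ 2 := by
      filter_upwards [hbd] with x hx
      have hr4 : |((x - m) * β).re| ≤ 1 / 4 :=
        (hre _).trans (by nlinarith [norm_nonneg β, norm_nonneg (x - m)])
      have hy2 : ‖x - m‖ ^ 2 ≤ B ^ 2 := by gcongr
      have hay : α * ‖x - m‖ ^ 2 ≤ 1 / 32 := by nlinarith
      have : 0 ≤ ‖β‖ ^ 2 * ‖x - m‖ ^ 2 := by positivity
      simp only [Pi.zero_apply]
      rw [abs_le] at hr4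
      nlinarith
    have hI1 : Integrable (fun x : ℂ => 1 - 2 * ((x - m) * β).re) ν :=
      (integrable_const _).sub (hint3.const_mul 2)
    have hI2 : Integrable (fun x : ℂ => (8 * ‖β‖ ^ 2 - α / 2) * ‖x - m‖ ^ 2) ν :=
      hint2.const_mul _
    have hI12 : Integrable (fun x : ℂ => 1 - 2 * ((x - m) * β).re +
        (8 * ‖β‖ ^ 2 - α / 2) * ‖x - m‖ ^ 2) ν := hI1.add hI2
    refine (lintegral_mono_ae hpt).trans ?_
    rw [← ofReal_integral_eq_lintegral_ofReal hI12 hnn]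
    apply ENNReal.ofReal_le_ofReal
    rw [integral_add hI1 hI2, integral_sub (integrable_const _) (hint3.const_mul 2),
      integral_const_mul, integral_const_mul, hmean3, ← hs]
    simp only [integral_const, probReal_univ, smul_eq_mul, mul_one, mul_zero, sub_zero]
    have h8 : 8 * ‖β‖ ^ 2 * s ≤ τ / 2 * ‖β‖ ^ 2 := by
      have : 8 * s ≤ τ / 2 := by nlinarith
      nlinarith [sq_nonneg ‖β‖]
    have := Real.add_one_le_exp (-(α * s / 2) + τ / 2 * ‖β‖ ^ 2)
    linarith
  · have hpt : ∀ᵐ x ∂ν, ENNReal.ofReal (Real.exp (-(2 * ((x - m) * β).re + α * ‖x - m‖ ^ 2))) ≤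
        ENNReal.ofReal (Real.exp (-(α * s / 2) + τ / 2 * ‖β‖ ^ 2)) := by
      filter_upwards [hbd] with x hx
      apply ENNReal.ofReal_le_ofReal
      apply Real.exp_le_exp.2
      have h1 := (abs_le.1 (hre (x - m))).1
      have h2 : ‖x - m‖ * ‖β‖ ≤ ‖β‖ * B := by nlinarith [norm_nonneg β]
      have h3 : 0 ≤ α * ‖x - m‖ ^ 2 := by positivity
      have h4 : α * s ≤ 1 / 32 := by nlinarith
      push Not at hb
      have h5 : 16 * (‖β‖ * B) ^ 2 ≤ τ / 2 * ‖β‖ ^ 2 := by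
        nlinarith [sq_nonneg ‖β‖]
      nlinarith
    refine (lintegral_mono_ae hpt).trans ?_
    simp

/-! ### Positive quadratic forms, their inverses and rank-one updates. -/

section QuadraticForms

variable {H : Type*} [NormedAddCommGroup H] [InnerProductSpace ℂ H]

/-- `T` is a symmetric operator bounded below by `τ > 0`, with right inverse `S`. -/
structure IsPosInversePair (T S : H →ₗ[ℂ] H) (τ : ℝ) : Prop where
  pos : 0 < τ
  symm : T.IsSymmetric
  lower : ∀ x, τ * ‖x‖ ^ 2 ≤ (inner ℂ (T x) x).re
  right_inv : ∀ x, T (S x) = x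

namespace IsPosInversePair

variable {T S : H →ₗ[ℂ] H} {τ : ℝ}

theorem symm_inv (h : IsPosInversePair T S τ) : S.IsSymmetric := fun x y => by
  conv_lhs => rw [← h.right_inv y]
  rw [← h.symm, h.right_inv]

theorem inner_inv_im (h : IsPosInversePair T S τ) (x : H) :
    inner ℂ (S x) x = ((inner ℂ (S x) x).re : ℂ) := by
  have h1 : inner ℂ (S x) x = inner ℂ x (S x) := h.symm_inv x x
  rw [← inner_conj_symm] at h1
  exact (Complex.conj_eq_iff_re.1 (by rw [inner_conj_symm, h.symm_inv x x])).symm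

theorem inv_lower (h : IsPosInversePair T S τ) (x : H) :
    τ * ‖S x‖ ^ 2 ≤ (inner ℂ (S x) x).re := by
  have := h.lower (S x)
  rwa [h.right_inv, ← h.symm_inv] at this

theorem inv_nonneg (h : IsPosInversePair T S τ) (x : H) : 0 ≤ (inner ℂ (S x) x).re :=
  (mul_nonneg h.pos.le (sq_nonneg _)).trans (h.inv_lower x)

theorem inv_upper (h : IsPosInversePair T S τ) (x : H) :
    (inner ℂ (S x) x).re * τ ≤ ‖x‖ ^ 2 := by
  have h1 := h.inv_lower x
  have h2 : (inner ℂ (S x) x).re ≤ ‖S x‖ * ‖x‖ := re_inner_le_norm (𝕜 := ℂ) _ _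
  have hτ := h.pos
  by_contra! hc
  nlinarith [sq_nonneg (τ * ‖S x‖ - ‖x‖)]

/-- An upper bound on `T` turns into a lower bound on its inverse. -/
theorem le_inv (h : IsPosInversePair T S τ) {c : ℝ} (hc : 0 < c) {x : H}
    (hT : (inner ℂ (T x) x).re ≤ c * ‖x‖ ^ 2) :
    ‖x‖ ^ 2 / c ≤ (inner ℂ (S x) x).re := by
  -- Expanding gives `⟨Tx, x⟩ - 2c‖x‖² + c²⟨Sx, x⟩ ≥ 0`.
  have h1 : (0 : ℝ) ≤ (inner ℂ (T (x - (c : ℂ) • S x)) (x - (c : ℂ) • S x)).re :=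
    (mul_nonneg h.pos.le (sq_nonneg _)).trans (h.lower _)
  rw [map_sub, map_smul, h.right_inv, inner_sub_left, inner_sub_right, inner_sub_right,
    inner_smul_left, inner_smul_right, inner_smul_left, inner_smul_right, h.symm x (S x),
    h.right_inv, ← h.symm_inv x x, inner_self_eq_norm_sq_to_K] at h1
  simp only [Complex.conj_ofReal, Complex.sub_re, Complex.re_ofReal_mul] at h1
  norm_cast at h1
  have h2 : ((‖x‖ ^ 2 : ℝ) : ℂ).re = ‖x‖ ^ 2 := Complex.ofReal_re _
  erw [h2] at h1
  rw [div_le_iff₀ hc]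
  by_contra! h3
  nlinarith [mul_lt_mul_of_pos_left h3 hc]

/-- The rank-one update `T + τ q q*`. -/
noncomputable def update (T : H →ₗ[ℂ] H) (τ : ℝ) (q : H) : H →ₗ[ℂ] H :=
  T + (τ : ℂ) • ((innerₛₗ ℂ q).smulRight q)

/-- The Sherman–Morrison inverse of the rank-one update. -/
noncomputable def updateInv (S : H →ₗ[ℂ] H) (τ : ℝ) (q : H) : H →ₗ[ℂ] H :=
  S - ((τ / (1 + τ * (inner ℂ (S q) q).re) : ℝ) : ℂ) • ((innerₛₗ ℂ (S q)).smulRight (S q))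

theorem update_apply (T : H →ₗ[ℂ] H) (τ : ℝ) (q x : H) :
    update T τ q x = T x + (τ : ℂ) • (inner ℂ q x : ℂ) • q := by
  simp [update]

theorem updateInv_apply (S : H →ₗ[ℂ] H) (τ : ℝ) (q x : H) :
    updateInv S τ q x = S x -
      ((τ / (1 + τ * (inner ℂ (S q) q).re) : ℝ) : ℂ) • (inner ℂ (S q) x : ℂ) • S q := by
  simp [updateInv]

theorem re_inner_update (T : H →ₗ[ℂ] H) (τ : ℝ) (q x : H) :
    (inner ℂ (update T τ q x) x).re = (inner ℂ (T x) x).re + τ * ‖(inner ℂ q x : ℂ)‖ ^ 2 := by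
  rw [update_apply, inner_add_left, inner_smul_left, inner_smul_left, Complex.conj_mul',
    Complex.conj_ofReal, Complex.add_re, Complex.re_ofReal_mul]
  norm_cast

theorem re_inner_updateInv (S : H →ₗ[ℂ] H) (τ : ℝ) (q x : H) :
    (inner ℂ (updateInv S τ q x) x).re = (inner ℂ (S x) x).re -
      τ / (1 + τ * (inner ℂ (S q) q).re) * ‖(inner ℂ (S q) x : ℂ)‖ ^ 2 := by
  rw [updateInv_apply, inner_sub_left, inner_smul_left, inner_smul_left, Complex.conj_mul',
    Complex.conj_ofReal, Complex.sub_re, Complex.re_ofReal_mul]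
  norm_cast

protected theorem rankOneUpdate (h : IsPosInversePair T S τ) (q : H) :
    IsPosInversePair (update T τ q) (updateInv S τ q) τ where
  pos := h.pos
  symm x y := by
    rw [update_apply, update_apply, inner_add_left, inner_add_right, h.symm x y, inner_smul_left,
      inner_smul_left, inner_smul_right, inner_smul_right, Complex.conj_ofReal, inner_conj_symm]
    ring
  lower x := by
    rw [re_inner_update]
    have := h.lower x
    have := mul_nonneg h.pos.le (sq_nonneg ‖(inner ℂ q x : ℂ)‖)
    linarith
  right_inv x := by
    have h1 : (inner ℂ q (S q) : ℂ) = ((inner ℂ (S q) q).re : ℂ) := by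
      rw [← h.symm_inv q q]; exact h.inner_inv_im q
    have h2 : (1 + τ * (inner ℂ (S q) q).re : ℝ) ≠ 0 := by
      have := mul_nonneg h.pos.le (h.inv_nonneg q)
      positivity
    rw [updateInv_apply, update_apply, map_sub, map_smul, map_smul, h.right_inv, h.right_inv,
      inner_sub_right, inner_smul_right, inner_smul_right, h1, h.symm_inv q x]
    set α := (inner ℂ (S q) q).re
    have h3 : ((τ / (1 + τ * α) : ℝ) : ℂ) * (1 + τ * α) = τ := by
      norm_cast; exact div_mul_cancel₀ _ h2
    set κ := ((τ / (1 + τ * α) : ℝ) : ℂ)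
    have h4 : x - κ • (inner ℂ q (S x) : ℂ) • q +
        (τ : ℂ) • (inner ℂ q (S x) - κ * (inner ℂ q (S x) * (α : ℂ)) : ℂ) • q =
        x + ((τ - κ * (1 + τ * α)) * inner ℂ q (S x)) • q := by module
    rw [h4, h3]
    simp

theorem re_inner_add_smul (h : IsPosInversePair T S τ) (b q : H) (y : ℂ) :
    (inner ℂ (S (b + y • q)) (b + y • q)).re = (inner ℂ (S b) b).re +
      (2 * (y * inner ℂ (S b) q).re + (inner ℂ (S q) q).re * ‖y‖ ^ 2) := by
  have h1 : (inner ℂ (S q) b : ℂ) = (starRingEnd ℂ) (inner ℂ (S b) q) := by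
    rw [inner_conj_symm, h.symm_inv]
  rw [map_add, map_smul, inner_add_left, inner_add_right, inner_add_right, inner_smul_left,
    inner_smul_right, inner_smul_left, inner_smul_right, h1, h.inner_inv_im q]
  simp only [Complex.add_re, ← map_mul, Complex.conj_re, ← mul_assoc]
  rw [Complex.conj_mul']
  norm_cast
  ring

end IsPosInversePair

end QuadraticForms

/-! ### Integrating out the coordinates one at a time. -/

/-- A probability measure on `ℂ` which, after conditioning to the ball of radius `M`, keeps
at least half of its mass and has variance at least `1 / 2`. -/
structure HasTruncatedVariance (μ : Measure ℂ) (M : ℝ) : Prop where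
  half_le_mass : 1 / 2 ≤ μ.real (Metric.closedBall 0 M)
  half_le_variance :
    1 / 2 ≤ ∫ x, ‖x - ∫ y, y ∂(μ[|Metric.closedBall 0 M])‖ ^ 2 ∂(μ[|Metric.closedBall 0 M])

section Induction

variable {H : Type*} [NormedAddCommGroup H] [InnerProductSpace ℂ H]

/-- Gaussian-type weight attached to a quadratic form. -/
noncomputable def quadWeight (S : H →ₗ[ℂ] H) (a : H) : ENNReal :=
  ENNReal.ofReal (Real.exp (-(inner ℂ (S a) a).re))

open IsPosInversePair

/-- Integrating out one bounded coordinate. -/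
theorem lintegral_quadWeight_le {T S : H →ₗ[ℂ] H} {τ : ℝ} (h : IsPosInversePair T S τ)
    {q : H} (hq : ‖q‖ ≤ 1) (hT : (inner ℂ (T q) q).re ≤ 2 * τ * ‖q‖ ^ 2)
    {μ : Measure ℂ} [IsProbabilityMeasure μ] {M : ℝ} (hM : HasTruncatedVariance μ M)
    (hτ : 128 * M ^ 2 ≤ τ) (b : H) :
    ∫⁻ x, quadWeight S (b + x • q) ∂(μ[|Metric.closedBall 0 M]) ≤
      ENNReal.ofReal (Real.exp (-(‖q‖ ^ 2 / (8 * τ)))) *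
        quadWeight (updateInv S τ q) (b + (∫ y, y ∂(μ[|Metric.closedBall 0 M])) • q) := by
  have hpos := h.pos
  have hmass : μ (Metric.closedBall 0 M) ≠ 0 := fun h0 => by
    have := hM.half_le_mass
    rw [Measure.real, h0] at this
    norm_num at this
  have : IsProbabilityMeasure (μ[|Metric.closedBall 0 M]) := cond_isProbabilityMeasure hmass
  set ν := μ[|Metric.closedBall 0 M] with hν
  have hbd : ∀ᵐ x ∂ν, ‖x‖ ≤ M := by
    have := ae_cond_mem (μ := μ) (Metric.isClosed_closedBall (x := (0 : ℂ)) (ε := M)).measurableSet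
    filter_upwards [this] with x hx
    simpa using hx
  have hint : Integrable (fun x : ℂ => x) ν := Integrable.of_bound (by fun_prop) M hbd
  have hm : ‖∫ y, y ∂ν‖ ≤ M := by
    simpa using norm_integral_le_of_norm_le_const hbd
  have hs := hM.half_le_variance
  rw [← hν] at hs
  set m := ∫ y, y ∂ν with hmdef
  set α := (inner ℂ (S q) q).re with hα
  have hα0 : 0 ≤ α := h.inv_nonneg q
  have hατ : α * τ ≤ 1 := (h.inv_upper q).trans (by nlinarith [norm_nonneg q])
  have hαl : ‖q‖ ^ 2 / (2 * τ) ≤ α := h.le_inv (by positivity) hT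
  have hbd' : ∀ᵐ x ∂ν, ‖x - m‖ ≤ 2 * M := by
    filter_upwards [hbd] with x hx
    exact (norm_sub_le _ _).trans (by linarith)
  have hmean : ∫ x, (x - m) ∂ν = 0 := by
    rw [integral_sub hint (integrable_const _)]
    simp [hmdef]
  -- Centring at `m` makes the deviation at most `2M`, whence `128 M² = 32 (2M)²`.
  have key := lintegral_exp_quadratic_le hα0 hατ (by linarith) hpos hbd' hmean
    (inner ℂ (S (b + m • q)) q)
  set s := ∫ x, ‖x - m‖ ^ 2 ∂ν
  have hfac : ∀ x : ℂ, quadWeight S (b + x • q) = quadWeight S (b + m • q) *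
      ENNReal.ofReal (Real.exp (-(2 * ((x - m) * inner ℂ (S (b + m • q)) q).re
        + α * ‖x - m‖ ^ 2))) := fun x => by
    have e1 : b + x • q = (b + m • q) + (x - m) • q := by module
    rw [quadWeight, quadWeight, ← ENNReal.ofReal_mul (Real.exp_nonneg _), ← Real.exp_add, e1,
      h.re_inner_add_smul (b + m • q) q (x - m)]
    congr 2
    ring
  rw [lintegral_congr hfac]
  rw [lintegral_const_mul' (quadWeight S (b + m • q)) _ ENNReal.ofReal_ne_top]
  refine (mul_le_mul_right key _).trans ?_
  rw [quadWeight, quadWeight, ← ENNReal.ofReal_mul (Real.exp_nonneg _),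
    ← ENNReal.ofReal_mul (Real.exp_nonneg _), ← Real.exp_add, ← Real.exp_add]
  apply ENNReal.ofReal_le_ofReal
  apply Real.exp_le_exp.2
  rw [re_inner_updateInv, ← hα]
  have hn : ‖(inner ℂ (S q) (b + m • q) : ℂ)‖ = ‖(inner ℂ (S (b + m • q)) q : ℂ)‖ := by
    rw [norm_inner_symm, h.symm_inv]
  rw [hn]
  -- Since `τα ≤ 1`, the Sherman–Morrison correction is at least `τ/2 ‖β‖²` with `β = ⟨S(b + mq),
  -- q⟩`: it absorbs the error of the one-variable bound.
  have h1 : τ / 2 ≤ τ / (1 + τ * α) := by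
    apply div_le_div_of_nonneg_left hpos.le
    · positivity
    · linarith
  have h2 : ‖q‖ ^ 2 / (8 * τ) = ‖q‖ ^ 2 / (2 * τ) / 4 := by
    rw [div_div]; ring_nf
  have h3 := mul_le_mul_of_nonneg_right h1 (sq_nonneg ‖(inner ℂ (S (b + m • q)) q : ℂ)‖)
  nlinarith

/-- Merges the two cases of the induction: only the mass `w` inside the ball earns the factor
`exp(-u)`, and a quarter of the exponent survives. -/
theorem one_sub_add_mul_exp_le {w u : ℝ} (hw : 1 / 2 ≤ w) (hu : 0 ≤ u)
    (hu1 : u ≤ 1 / 2) : (1 - w) + w * Real.exp (-u) ≤ Real.exp (-(u / 4)) := by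
  have h1 := (abs_le.1 (Real.abs_exp_sub_one_sub_id_le (x := -u) (by
    rw [abs_le]; constructor <;> linarith))).2
  have h2 : Real.exp (-u) ≤ 1 - u / 2 := by nlinarith
  have h4 := Real.add_one_le_exp (-(u / 4))
  nlinarith

/-- Laplace transform bound for the quadratic form of a vector with iid coefficients. -/
theorem lintegral_pi_quadWeight_le {μ : Measure ℂ} [IsProbabilityMeasure μ] {M τ : ℝ}
    (hM : HasTruncatedVariance μ M) (hτ : 128 * M ^ 2 ≤ τ) (hτ1 : 1 ≤ τ) (n : ℕ) :
    ∀ (q : Fin n → H) {T S : H →ₗ[ℂ] H} (_ : IsPosInversePair T S τ)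
      (_ : ∀ x, (inner ℂ (T x) x).re + τ * ∑ j, ‖(inner ℂ (q j) x : ℂ)‖ ^ 2 ≤ 2 * τ * ‖x‖ ^ 2)
      (a : H),
    ∫⁻ x, quadWeight S (a + ∑ j, x j • q j) ∂(Measure.pi fun _ : Fin n => μ) ≤
      ENNReal.ofReal (Real.exp (-(∑ j, ‖q j‖ ^ 2 / (32 * τ)))) := by
  induction n with
  | zero =>
    intro q T S h hT a
    have : quadWeight S a ≤ 1 := by
      rw [quadWeight, ENNReal.ofReal_le_one, Real.exp_le_one_iff]
      linarith [h.inv_nonneg a]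
    simpa using this
  | succ n ih =>
    intro q T S h hT a
    have hpos := h.pos
    have hT0 : ∀ x, (inner ℂ (T x) x).re + τ * ‖(inner ℂ (q 0) x : ℂ)‖ ^ 2 +
        τ * ∑ j : Fin n, ‖(inner ℂ (q j.succ) x : ℂ)‖ ^ 2 ≤ 2 * τ * ‖x‖ ^ 2 := fun x => by
      have := hT x
      rw [Fin.sum_univ_succ] at this
      linarith
    have hsum0 : ∀ x, 0 ≤ τ * ∑ j : Fin n, ‖(inner ℂ (q j.succ) x : ℂ)‖ ^ 2 := fun x =>
      mul_nonneg hpos.le (Finset.sum_nonneg fun _ _ => sq_nonneg _)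
    -- Testing the upper bound at `q 0` itself gives `τ‖q‖² + τ‖q‖⁴ ≤ 2τ‖q‖²`.
    have hq0 : ‖q 0‖ ≤ 1 := by
      have h1 := hT0 (q 0)
      have h2 := h.lower (q 0)
      have h3 := hsum0 (q 0)
      rw [inner_self_eq_norm_sq_to_K, norm_pow, RCLike.norm_ofReal, abs_norm] at h1
      by_contra! hc
      have h4 : (‖q 0‖ ^ 2) ^ 2 ≤ ‖q 0‖ ^ 2 := by
        refine le_of_mul_le_mul_left ?_ hpos
        linarith
      have h5 : 1 < ‖q 0‖ ^ 2 := by nlinarith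
      nlinarith
    have hTq : (inner ℂ (T (q 0)) (q 0)).re ≤ 2 * τ * ‖q 0‖ ^ 2 := by
      have := hT0 (q 0)
      have := hsum0 (q 0)
      have : 0 ≤ τ * ‖(inner ℂ (q 0) (q 0) : ℂ)‖ ^ 2 := by positivity
      linarith
    set E := ENNReal.ofReal (Real.exp (-(∑ j : Fin n, ‖q j.succ‖ ^ 2 / (32 * τ)))) with hE
    set D := Metric.closedBall (0 : ℂ) M with hD
    have hDm : MeasurableSet D := Metric.isClosed_closedBall.measurableSet
    have hmeas : Measurable fun p : ℂ × (Fin n → ℂ) =>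
        quadWeight S (a + (p.1 • q 0 + ∑ j, p.2 j • q j.succ)) := by
      unfold quadWeight
      simp only [map_add, map_sum, map_smul]
      refine Continuous.measurable (ENNReal.continuous_ofReal.comp ?_)
      fun_prop
    have hstep : ∫⁻ x, quadWeight S (a + ∑ j, x j • q j) ∂(Measure.pi fun _ : Fin (n + 1) => μ) =
        ∫⁻ x, ∫⁻ y, quadWeight S (a + (x • q 0 + ∑ j, y j • q j.succ))
          ∂(Measure.pi fun _ : Fin n => μ) ∂μ := by
      rw [← lintegral_prod _ hmeas.aemeasurable,
        ← (measurePreserving_piFinSuccAbove (fun _ : Fin (n + 1) => μ) 0).lintegral_comp hmeas]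
      simp [Fin.sum_univ_succ, MeasurableEquiv.piFinSuccAbove, Fin.insertNthEquiv, Fin.tail]
    rw [hstep, ← lintegral_add_compl _ hDm]
    have hw : μ.real D ≤ 1 := measureReal_le_one
    have hwE : μ D = ENNReal.ofReal (μ.real D) := (ofReal_measureReal).symm
    have hwC : μ Dᶜ = ENNReal.ofReal (1 - μ.real D) := by
      rw [← probReal_compl_eq_one_sub hDm, ofReal_measureReal]
    have hlarge : ∫⁻ x in Dᶜ, ∫⁻ y, quadWeight S (a + (x • q 0 + ∑ j, y j • q j.succ))
          ∂(Measure.pi fun _ : Fin n => μ) ∂μ ≤ ENNReal.ofReal (1 - μ.real D) * E := by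
      calc _ ≤ ∫⁻ x in Dᶜ, E ∂μ := by
            refine lintegral_mono fun x => ?_
            simp_rw [← add_assoc]
            refine ih (fun j => q j.succ) h (fun z => ?_) (a + x • q 0)
            have := hT0 z
            have : 0 ≤ τ * ‖(inner ℂ (q 0) z : ℂ)‖ ^ 2 := by positivity
            linarith
        _ = _ := by rw [setLIntegral_const, hwC, mul_comm]
    have hsmall : ∫⁻ x in D, ∫⁻ y, quadWeight S (a + (x • q 0 + ∑ j, y j • q j.succ))
          ∂(Measure.pi fun _ : Fin n => μ) ∂μ ≤
        ENNReal.ofReal (μ.real D) *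
          (ENNReal.ofReal (Real.exp (-(‖q 0‖ ^ 2 / (8 * τ)))) * E) := by
      have hD0 : μ D ≠ 0 := fun h0 => by
        have := hM.half_le_mass
        rw [← hD, Measure.real, h0] at this
        norm_num at this
      have hrestr : μ.restrict D = μ D • μ[|D] := by
        rw [ProbabilityTheory.cond, smul_smul, ENNReal.mul_inv_cancel hD0 (measure_ne_top _ _),
          one_smul]
      rw [hrestr, lintegral_smul_measure, hwE, smul_eq_mul]
      refine mul_le_mul_right ?_ _
      have : IsProbabilityMeasure (μ[|D]) := cond_isProbabilityMeasure hD0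
      rw [lintegral_lintegral_swap hmeas.aemeasurable]
      calc _ ≤ ∫⁻ y, ENNReal.ofReal (Real.exp (-(‖q 0‖ ^ 2 / (8 * τ)))) *
              quadWeight (updateInv S τ (q 0)) ((a + (∫ y, y ∂(μ[|D])) • q 0) +
                ∑ j, y j • q j.succ) ∂(Measure.pi fun _ : Fin n => μ) := by
            refine lintegral_mono fun y => ?_
            have := lintegral_quadWeight_le h hq0 hTq hM hτ (a + ∑ j, y j • q j.succ)
            have e1 : ∀ z : H, a + (z + ∑ j, y j • q j.succ) = a + ∑ j, y j • q j.succ + z :=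
              fun z => by abel
            rw [add_right_comm a]
            simp_rw [e1]
            exact this
        _ ≤ _ := by
            rw [lintegral_const_mul' _ _ ENNReal.ofReal_ne_top]
            refine mul_le_mul_right ?_ _
            -- The upper bound is preserved exactly: the term of `q 0` moves from the sum into `T`.
            refine ih (fun j => q j.succ) (h.rankOneUpdate (q 0)) (fun z => ?_) _
            rw [re_inner_update]
            exact hT0 z
    refine (add_le_add hsmall hlarge).trans ?_
    rw [← mul_assoc, ← add_mul, ← ENNReal.ofReal_mul measureReal_nonneg,
      ← ENNReal.ofReal_add (by positivity) (by linarith), hE,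
      ← ENNReal.ofReal_mul (add_nonneg (by positivity) (by linarith)),
      Fin.sum_univ_succ, neg_add, Real.exp_add]
    apply ENNReal.ofReal_le_ofReal
    refine mul_le_mul_of_nonneg_right ?_ (Real.exp_nonneg _)
    have hu1 : ‖q 0‖ ^ 2 / (8 * τ) ≤ 1 / 2 := by
      rw [div_le_iff₀ (by positivity)]
      nlinarith [norm_nonneg (q 0)]
    have := one_sub_add_mul_exp_le hM.half_le_mass (u := ‖q 0‖ ^ 2 / (8 * τ)) (by positivity) hu1
    have e : ‖q 0‖ ^ 2 / (32 * τ) = ‖q 0‖ ^ 2 / (8 * τ) / 4 := by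
      rw [div_div]; ring_nf
    rw [e]
    linarith

end Induction

/-! ### Truncation. -/

/-- A centred distribution of unit variance keeps mass and variance after a large truncation. -/
theorem exists_hasTruncatedVariance {μ : Measure ℂ} [IsProbabilityMeasure μ]
    (h2 : MemLp id 2 μ) (h0 : ∫ x, x ∂μ = 0) (h1 : ∫ x, ‖x‖ ^ 2 ∂μ = 1) :
    ∃ M : ℝ, HasTruncatedVariance μ M := by
  have hlim : ∀ {F : Type} [NormedAddCommGroup F] [NormedSpace ℝ F] (f : ℂ → F), Integrable f μ →
      Filter.Tendsto (fun N : ℕ => ∫ x in Metric.closedBall (0 : ℂ) N, f x ∂μ) Filter.atTop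
        (nhds (∫ x, f x ∂μ)) := by
    intro F _ _ f hf
    have := tendsto_setIntegral_of_monotone (μ := μ) (f := f)
      (s := fun N : ℕ => Metric.closedBall (0 : ℂ) N)
      (fun N => Metric.isClosed_closedBall.measurableSet)
      (fun a b hab => Metric.closedBall_subset_closedBall (by exact_mod_cast hab))
      hf.integrableOn
    rwa [Metric.iUnion_closedBall_nat, setIntegral_univ] at this
  have hi1 : Integrable (fun x : ℂ => x) μ := h2.integrable (by norm_num)
  have hi2 : Integrable (fun x : ℂ => ‖x‖ ^ 2) μ := h2.integrable_norm_pow (by norm_num)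
  have l1 := (hlim _ hi1).norm
  rw [h0, norm_zero] at l1
  have l2 := hlim _ hi2
  rw [h1] at l2
  have l3 := hlim (fun _ => (1 : ℝ)) (integrable_const _)
  simp only [integral_const, probReal_univ, smul_eq_mul, mul_one, measureReal_restrict_apply_univ] at l3
  -- Conditioning at most doubles the mean, to 1/4, and does not lower the second moment, so the
  -- variance is at least `3/4 - 1/16`.
  obtain ⟨N, hN1, hN2, hN3⟩ := ((l1.eventually (gt_mem_nhds (by norm_num : (0 : ℝ) < 1 / 8))).and
    ((l2.eventually (lt_mem_nhds (by norm_num : (3 / 4 : ℝ) < 1))).and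
      (l3.eventually (lt_mem_nhds (by norm_num : (1 / 2 : ℝ) < 1))))).exists
  refine ⟨N, hN3.le, ?_⟩
  set D := Metric.closedBall (0 : ℂ) (N : ℝ)
  have hD0 : μ D ≠ 0 := fun h => by
    rw [Measure.real, h] at hN3
    norm_num at hN3
  have : IsProbabilityMeasure (μ[|D]) := cond_isProbabilityMeasure hD0
  have hcond : ∀ {F : Type} [NormedAddCommGroup F] [NormedSpace ℝ F] (f : ℂ → F),
      ∫ x, f x ∂(μ[|D]) = (μ.real D)⁻¹ • ∫ x in D, f x ∂μ := fun f => by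
    rw [ProbabilityTheory.cond, integral_smul_measure, ENNReal.toReal_inv]
    rfl
  have hic : ∀ {F : Type} [NormedAddCommGroup F] [NormedSpace ℝ F] (f : ℂ → F),
      Integrable f μ → Integrable f (μ[|D]) := fun f hf =>
    hf.integrableOn.smul_measure (ENNReal.inv_ne_top.2 hD0)
  have hw0 : 0 < μ.real D := by linarith
  have hw1 : μ.real D ≤ 1 := measureReal_le_one
  have hwinv : (μ.real D)⁻¹ ≤ 2 := by
    rw [inv_le_comm₀ hw0 (by norm_num)]; linarith
  have hm : ‖∫ y, y ∂(μ[|D])‖ ≤ 1 / 4 := by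
    rw [hcond, norm_smul, Real.norm_of_nonneg (by positivity)]
    nlinarith [norm_nonneg (∫ y in D, y ∂μ)]
  have hA : 3 / 4 ≤ ∫ x, ‖x‖ ^ 2 ∂(μ[|D]) := by
    rw [hcond, smul_eq_mul]
    have : 1 ≤ (μ.real D)⁻¹ := (one_le_inv₀ hw0).2 hw1
    nlinarith
  set m := ∫ y, y ∂(μ[|D]) with hmdef
  have hinner : ∫ x, inner ℝ m x ∂(μ[|D]) = ‖m‖ ^ 2 := by
    rw [integral_inner (hic _ hi1), ← hmdef, real_inner_self_eq_norm_sq]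
  have hi3 : Integrable (fun x : ℂ => inner ℝ m x) (μ[|D]) := (hic _ hi1).const_inner m
  have hexp : ∫ x, ‖x - m‖ ^ 2 ∂(μ[|D]) = ∫ x, ‖x‖ ^ 2 ∂(μ[|D]) - ‖m‖ ^ 2 := by
    have e : ∀ x : ℂ, ‖x - m‖ ^ 2 = ‖x‖ ^ 2 - 2 * inner ℝ m x + ‖m‖ ^ 2 := fun x => by
      rw [norm_sub_sq_real, real_inner_comm]
    simp_rw [e]
    have hi4 : Integrable (fun x : ℂ => ‖x‖ ^ 2 - 2 * inner ℝ m x) (μ[|D]) :=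
      (hic _ hi2).sub (hi3.const_mul 2)
    rw [integral_add hi4 (integrable_const _), integral_sub (hic _ hi2) (hi3.const_mul 2),
      integral_const_mul, hinner]
    simp
    ring
  rw [hexp]
  nlinarith [norm_nonneg m]

/-! ### Geometry of the projection to the normal space, and the tail bound. -/

section Projection

variable {n : ℕ} (V : Submodule ℂ (EuclideanSpace ℂ (Fin n)))

/-- The projection of the `j`-th basis vector to the orthogonal complement of `V`. -/
noncomputable def normalComponent (j : Fin n) : EuclideanSpace ℂ (Fin n) :=
  Vᗮ.starProjection (EuclideanSpace.single j 1)

theorem inner_normalComponent (j : Fin n) (x : EuclideanSpace ℂ (Fin n)) :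
    inner ℂ (normalComponent V j) x = Vᗮ.starProjection x j := by
  rw [normalComponent, Submodule.inner_starProjection_left_eq_right,
    EuclideanSpace.inner_single_left]
  simp

theorem sum_norm_inner_normalComponent_le {σ : Fin n → ℝ} (hσ : ∀ j, σ j ∈ Set.Icc (0 : ℝ) 1)
    (x : EuclideanSpace ℂ (Fin n)) :
    ∑ j, ‖(inner ℂ ((σ j : ℂ) • normalComponent V j) x : ℂ)‖ ^ 2 ≤ ‖x‖ ^ 2 := by
  calc _ ≤ ∑ j, ‖Vᗮ.starProjection x j‖ ^ 2 := by
        refine Finset.sum_le_sum fun j _ => ?_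
        rw [inner_smul_left, inner_normalComponent, norm_mul, RCLike.norm_conj, Complex.norm_real,
          Real.norm_of_nonneg (hσ j).1]
        have := (hσ j).2
        have := (hσ j).1
        gcongr
        exact mul_le_of_le_one_left (norm_nonneg _) (hσ j).2
    _ = ‖Vᗮ.starProjection x‖ ^ 2 := (EuclideanSpace.norm_sq_eq _).symm
    _ ≤ ‖x‖ ^ 2 := by
        gcongr
        exact Submodule.norm_starProjection_apply_le _ _

theorem starProjection_weightedVec_add (σ : Fin n → ℝ) (x : Fin n → ℂ)
    (v : EuclideanSpace ℂ (Fin n)) :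
    Vᗮ.starProjection (weightedVec σ x + v) =
      Vᗮ.starProjection v + ∑ j, x j • (σ j : ℂ) • normalComponent V j := by
  have e : weightedVec σ x = ∑ j, x j • (σ j : ℂ) • EuclideanSpace.single j (1 : ℂ) := by
    ext i
    simp [weightedVec, Finset.sum_apply, Pi.single_apply, mul_comm]
  rw [map_add, add_comm, e, map_sum]
  simp [normalComponent]

theorem norm_starProjection_orthogonal_le_infDist (y : EuclideanSpace ℂ (Fin n)) :
    ‖Vᗮ.starProjection y‖ ≤ Metric.infDist y (V : Set (EuclideanSpace ℂ (Fin n))) := by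
  refine (Metric.le_infDist ⟨0, V.zero_mem⟩).2 fun z hz => ?_
  have hz0 : Vᗮ.starProjection z = 0 := by
    rw [Submodule.starProjection_apply_eq_zero_iff]
    exact V.le_orthogonal_orthogonal hz
  calc ‖Vᗮ.starProjection y‖ = ‖Vᗮ.starProjection (y - z)‖ := by rw [map_sub, hz0, sub_zero]
    _ ≤ ‖y - z‖ := Submodule.norm_starProjection_apply_le _ _
    _ = dist y z := (dist_eq_norm _ _).symm

/-- An incompressible vector has mass at least `ρ ^ 2` on every large coordinate set. -/
theorem sq_lt_sum_of_mem_incompr {δ ρ : ℝ} (hδ : 0 < δ) (hρ : 0 < ρ)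
    {u : EuclideanSpace ℂ (Fin n)} (hu : u ∈ Incompr n (1 - δ / 2) ρ) {G : Finset (Fin n)}
    (hG : δ * n ≤ G.card) : ρ ^ 2 < ∑ j ∈ G, ‖u j‖ ^ 2 := by
  have hGn : (G.card : ℝ) ≤ n := by
    exact_mod_cast (Finset.card_le_univ G).trans_eq (Fintype.card_fin n)
  have hn0 : (0 : ℝ) ≤ n := Nat.cast_nonneg n
  have hcard : Gᶜ.card ≤ ⌊(1 - δ / 2) * n⌋₊ := by
    apply Nat.le_floor
    rw [Finset.card_compl, Fintype.card_fin, Nat.cast_sub (by exact_mod_cast hGn)]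
    nlinarith
  have hfl : ⌊(1 - δ / 2) * n⌋₊ ≤ (Finset.univ : Finset (Fin n)).card := by
    rw [Finset.card_univ, Fintype.card_fin]
    refine Nat.floor_le_of_le ?_
    nlinarith
  -- Compressibility asks for an exact cardinality, so `Gᶜ` is enlarged to `J`; then `u - w` still
  -- lives on `G`.
  obtain ⟨J, hGJ, -, hJ⟩ := Finset.exists_subsuperset_card_eq (Finset.subset_univ Gᶜ) hcard hfl
  set w : EuclideanSpace ℂ (Fin n) := WithLp.toLp 2 fun j => if j ∈ J then u j else 0 with hw
  have hwJ : w ∈ coordSubspace J := by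
    show ∀ i, i ∉ J → w i = 0
    intro i hi
    simp [hw, hi]
  have hd : ρ < dist u w := by
    by_contra! hle
    refine hu.2 ⟨hu.1, ?_⟩
    simp only [Set.mem_iUnion]
    exact ⟨J, hJ, Metric.mem_cthickening_of_dist_le u w ρ _ hwJ hle⟩
  calc ρ ^ 2 < dist u w ^ 2 := by gcongr
    _ = ∑ j, ‖u j - w j‖ ^ 2 := by rw [dist_eq_norm, EuclideanSpace.norm_sq_eq]; rfl
    _ = ∑ j ∈ G, ‖u j - w j‖ ^ 2 := by
        symm
        apply Finset.sum_subset (Finset.subset_univ _)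
        intro j _ hj
        have : j ∈ J := hGJ (Finset.mem_compl.2 hj)
        simp [hw, this]
    _ ≤ ∑ j ∈ G, ‖u j‖ ^ 2 := by
        refine Finset.sum_le_sum fun j _ => ?_
        by_cases hj : j ∈ J <;> simp [hw, hj]

theorem norm_normalComponent_sq (j : Fin n) :
    ‖normalComponent V j‖ ^ 2 =
      ∑ i, ‖((stdOrthonormalBasis ℂ Vᗮ i : Vᗮ) : EuclideanSpace ℂ (Fin n)) j‖ ^ 2 := by
  have hmem : normalComponent V j ∈ Vᗮ := Submodule.starProjection_apply_mem _ _
  have := (stdOrthonormalBasis ℂ Vᗮ).sum_sq_norm_inner_right ⟨_, hmem⟩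
  rw [Submodule.coe_norm] at this
  rw [← this]
  refine Finset.sum_congr rfl fun i _ => ?_
  rw [Submodule.coe_inner, norm_inner_symm, inner_normalComponent,
    Submodule.starProjection_eq_self_iff.2 (Submodule.coe_mem _)]

/-- If all unit normal vectors are incompressible, large coordinate sets carry a proportion
`ρ ^ 2` of the trace of the projection. -/
theorem mul_sq_le_sum_norm_normalComponent {k : ℕ} (hk : Module.finrank ℂ V + k = n) {δ ρ : ℝ}
    (hδ : 0 < δ) (hρ : 0 < ρ) (hV : ∀ u ∈ Vᗮ, ‖u‖ = 1 → u ∈ Incompr n (1 - δ / 2) ρ)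
    {G : Finset (Fin n)} (hG : δ * n ≤ G.card) :
    k * ρ ^ 2 ≤ ∑ j ∈ G, ‖normalComponent V j‖ ^ 2 := by
  have hk' : Module.finrank ℂ Vᗮ = k := by
    have := V.finrank_add_finrank_orthogonal
    rw [finrank_euclideanSpace, Fintype.card_fin] at this
    omega
  simp_rw [norm_normalComponent_sq]
  rw [Finset.sum_comm]
  calc (k : ℝ) * ρ ^ 2 = ∑ _i : Fin (Module.finrank ℂ Vᗮ), ρ ^ 2 := by simp [hk']
    _ ≤ _ := Finset.sum_le_sum fun i _ =>
        (sq_lt_sum_of_mem_incompr hδ hρ (hV _ (Submodule.coe_mem _) (by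
          rw [← Submodule.coe_norm]; exact (stdOrthonormalBasis ℂ Vᗮ).norm_eq_one i)) hG).le

/-- Lower-tail bound for the distance of a weighted iid vector to a subspace. -/
theorem measureReal_infDist_le {μ : Measure ℂ} [IsProbabilityMeasure μ] {M τ : ℝ}
    (hM : HasTruncatedVariance μ M) (hτ : 128 * M ^ 2 ≤ τ) (hτ1 : 1 ≤ τ)
    {Ω : Type*} [MeasurableSpace Ω] {P : Measure Ω} [IsProbabilityMeasure P]
    {X : Fin n → Ω → ℂ} (hX : iIndepFun X P) (hXm : ∀ j, AEMeasurable (X j) P)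
    (hXμ : ∀ j, P.map (X j) = μ) {σ : Fin n → ℝ} (hσ : ∀ j, σ j ∈ Set.Icc (0 : ℝ) 1)
    (v : EuclideanSpace ℂ (Fin n)) (r : ℝ) :
    P.real {ω | Metric.infDist (weightedVec σ (fun j => X j ω) + v)
        (V : Set (EuclideanSpace ℂ (Fin n))) ≤ r} ≤
      Real.exp (r ^ 2 / τ - ∑ j, σ j ^ 2 * ‖normalComponent V j‖ ^ 2 / (32 * τ)) := by
  have hτ0 : 0 < τ := by linarith
  let q : Fin n → EuclideanSpace ℂ (Fin n) := fun j => (σ j : ℂ) • normalComponent V j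
  let T : EuclideanSpace ℂ (Fin n) →ₗ[ℂ] EuclideanSpace ℂ (Fin n) := (τ : ℂ) • LinearMap.id
  let S : EuclideanSpace ℂ (Fin n) →ₗ[ℂ] EuclideanSpace ℂ (Fin n) :=
    ((τ⁻¹ : ℝ) : ℂ) • LinearMap.id
  have hre : ∀ (c : ℝ) (x : EuclideanSpace ℂ (Fin n)),
      (inner ℂ ((c : ℂ) • x) x).re = c * ‖x‖ ^ 2 := fun c x => by
    rw [inner_smul_left, Complex.conj_ofReal, Complex.re_ofReal_mul]
    congr 1
    exact inner_self_eq_norm_sq (𝕜 := ℂ) x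
  have hTS : IsPosInversePair T S τ :=
    { pos := hτ0
      symm := fun x y => by
        change inner ℂ ((τ : ℂ) • x) y = inner ℂ x ((τ : ℂ) • y)
        rw [inner_smul_left, inner_smul_right, Complex.conj_ofReal]
      lower := fun x => (hre τ x).ge
      right_inv := fun x => by
        have : (τ : ℂ) ≠ 0 := by exact_mod_cast hτ0.ne'
        change (τ : ℂ) • ((τ⁻¹ : ℝ) : ℂ) • x = x
        rw [smul_smul, Complex.ofReal_inv, mul_inv_cancel₀ this, one_smul] }
  have hT : ∀ x, (inner ℂ (T x) x).re + τ * ∑ j, ‖(inner ℂ (q j) x : ℂ)‖ ^ 2 ≤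
      2 * τ * ‖x‖ ^ 2 := fun x => by
    have h1 := hre τ x
    have h2 := mul_le_mul_of_nonneg_left (sum_norm_inner_normalComponent_le V hσ x) hτ0.le
    change (inner ℂ ((τ : ℂ) • x) x).re + _ ≤ _
    linarith
  have hbound := lintegral_pi_quadWeight_le hM hτ hτ1 n q hTS hT (Vᗮ.starProjection v)
  have hgm : Measurable fun x : Fin n → ℂ =>
      quadWeight S (Vᗮ.starProjection v + ∑ j, x j • q j) := by
    unfold quadWeight
    simp only [map_add, map_sum, map_smul]
    refine Continuous.measurable (ENNReal.continuous_ofReal.comp ?_)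
    fun_prop
  have hXm' : AEMeasurable (fun ω j => X j ω) P := aemeasurable_pi_iff.2 hXm
  have hmap : P.map (fun ω j => X j ω) = Measure.pi fun _ : Fin n => μ := by
    rw [hX.map_fun_eq_pi_map hXm]
    simp_rw [hXμ]
  rw [← hmap, lintegral_map' hgm.aemeasurable hXm'] at hbound
  have hsub : {ω | Metric.infDist (weightedVec σ (fun j => X j ω) + v)
        (V : Set (EuclideanSpace ℂ (Fin n))) ≤ r} ⊆
      {ω | ENNReal.ofReal (Real.exp (-(r ^ 2 / τ))) ≤
        quadWeight S (Vᗮ.starProjection v + ∑ j, X j ω • q j)} := by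
    intro ω hω
    have h1 := (norm_starProjection_orthogonal_le_infDist V _).trans hω
    rw [starProjection_weightedVec_add] at h1
    apply ENNReal.ofReal_le_ofReal
    apply Real.exp_le_exp.2
    rw [neg_le_neg_iff]
    refine (hre τ⁻¹ _).trans_le ?_
    rw [inv_mul_eq_div]
    gcongr
    exact h1
  have hpos : 0 < Real.exp (-(r ^ 2 / τ)) := Real.exp_pos _
  -- Markov's inequality at level `exp(-r²/τ)`.
  have hmark := (measure_mono hsub).trans
    ((meas_ge_le_lintegral_div (hgm.comp_aemeasurable hXm')
      (ENNReal.ofReal_pos.2 hpos).ne' ENNReal.ofReal_ne_top).trans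
      (ENNReal.div_le_div_right hbound _))
  rw [← ENNReal.ofReal_div_of_pos hpos, ← Real.exp_sub] at hmark
  refine (ENNReal.toReal_le_of_le_ofReal (Real.exp_nonneg _) hmark).trans_eq ?_
  congr 1
  have : ∀ j, ‖q j‖ ^ 2 = σ j ^ 2 * ‖normalComponent V j‖ ^ 2 := fun j => by
    simp [q, norm_smul, mul_pow]
  simp_rw [this]
  ring

end Projection

theorem sum_norm_normalComponent_le {n : ℕ} (V : Submodule ℂ (EuclideanSpace ℂ (Fin n)))
    (G : Finset (Fin n)) : ∑ j ∈ G, ‖normalComponent V j‖ ^ 2 ≤ n := by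
  have h1 : ∀ j, ‖normalComponent V j‖ ^ 2 ≤ 1 := fun j => by
    have : ‖normalComponent V j‖ ≤ 1 :=
      (Submodule.norm_starProjection_apply_le _ _).trans_eq (by simp)
    exact pow_le_one₀ (norm_nonneg _) this
  calc _ ≤ ∑ j, ‖normalComponent V j‖ ^ 2 :=
        Finset.sum_le_sum_of_subset_of_nonneg (Finset.subset_univ _) fun _ _ _ => by positivity
    _ ≤ ∑ _j : Fin n, (1 : ℝ) := Finset.sum_le_sum fun j _ => h1 j
    _ = n := by simp

/-! ### Choice of constants and conclusion. -/

theorem lemma5p2 :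
    ∃ c : ℝ, 0 < c ∧ ∃ C : ℝ, 0 < C ∧
      ∀ ε : ℝ, 0 < ε → ε < 1 →
      -- the common distribution of the entries: that of a centred `ξ` of unit variance
      ∀ (Ω₀ : Type*) [MeasurableSpace Ω₀] (P₀ : Measure Ω₀) [IsProbabilityMeasure P₀]
        (ξ : Ω₀ → ℂ), MemLp ξ 2 P₀ → ∫ ω, ξ ω ∂P₀ = 0 → ∫ ω, ‖ξ ω‖ ^ 2 ∂P₀ = 1 →
      ∃ K : ℝ, 0 < K ∧
      ∀ (n k : ℕ) (Ω : Type*) [MeasurableSpace Ω] (P : Measure Ω) [IsProbabilityMeasure P]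
        (X : Fin n → Ω → ℂ), iIndepFun X P → (∀ j, IdentDistrib (X j) ξ P P₀) →
      ∀ σ : Fin n → ℝ, (∀ j, σ j ∈ Set.Icc (0 : ℝ) 1) →
      ∀ δ : ℝ, 0 < δ → δ < 1 → ∀ σ₀ : ℝ, 0 < σ₀ → σ₀ < 1 →
        δ * (n : ℝ) ≤ (({j : Fin n | σ₀ ≤ σ j} : Set (Fin n)).ncard : ℝ) →
      ∀ V : Submodule ℂ (EuclideanSpace ℂ (Fin n)), Module.finrank ℂ V + k = n →
      ∀ ρ : ℝ, 0 < ρ → (∀ u ∈ Vᗮ, ‖u‖ = 1 → u ∈ Incompr n (1 - δ / 2) ρ) →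
        C * (n : ℝ) ^ ε / (σ₀ ^ 2 * ρ ^ 2 * δ) ≤ (k : ℝ) → (k : ℝ) ≤ (n : ℝ) - 1 →
      ∀ v : EuclideanSpace ℂ (Fin n),
        P.real {ω | Metric.infDist (weightedVec σ (fun j => X j ω) + v)
              (V : Set (EuclideanSpace ℂ (Fin n))) ≤ c * σ₀ * ρ * Real.sqrt (δ * k)}
          ≤ K * Real.exp (-(c * σ₀ ^ 2 * ρ ^ 2 * δ * k / (n : ℝ) ^ ε)) := by
  -- With `τ = 128 n^ε` the gain has coefficient `1/(32·128) = 1/4096`. Half of it is `c`; the other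
  -- half covers the Markov loss `c²/128`.
  refine ⟨1 / 8192, by norm_num, 1, one_pos, ?_⟩
  intro ε hε _ Ω₀ _ P₀ _ ξ hξ hξ0 hξ1
  have hξm : AEMeasurable ξ P₀ := hξ.1.aemeasurable
  have : IsProbabilityMeasure (P₀.map ξ) := Measure.isProbabilityMeasure_map hξm
  obtain ⟨M, hM⟩ := exists_hasTruncatedVariance (μ := P₀.map ξ)
    ((memLp_map_measure_iff (by fun_prop) hξm).2 hξ)
    (by rwa [integral_map hξm (by fun_prop)]) (by rwa [integral_map hξm (by fun_prop)])
  -- `M` depends on the law of `ξ`, while `c` must be absolute: the factor `n^ε` absorbs `M²` beyond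
  -- some `n₀`.
  obtain ⟨n₀, hn₀⟩ := Filter.eventually_atTop.1
    (((tendsto_rpow_atTop hε).comp tendsto_natCast_atTop_atTop).eventually_ge_atTop (M ^ 2))
  refine ⟨Real.exp n₀, Real.exp_pos _, ?_⟩
  intro n k Ω _ P _ X hX hid σ hσ δ hδ hδ1 σ₀ hσ₀ hσ₀1 hcard V hV ρ hρ hinc _ _ v
  classical
  set G : Finset (Fin n) := Finset.univ.filter fun j => σ₀ ≤ σ j with hG
  have hcardG : δ * n ≤ G.card := by
    rwa [Set.ncard_eq_toFinset_card', Set.toFinset_ofPred] at hcard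
  have hkG := mul_sq_le_sum_norm_normalComponent V hV hδ hρ hinc hcardG
  have hn0 : (0 : ℝ) ≤ n := Nat.cast_nonneg n
  have hk0 : (0 : ℝ) ≤ k := Nat.cast_nonneg k
  have hσsq : σ₀ ^ 2 ≤ 1 := pow_le_one₀ hσ₀.le hσ₀1.le
  rcases Nat.eq_zero_or_pos n with hn | hn
  · subst hn
    have hk : k = 0 := by omega
    subst hk
    refine measureReal_le_one.trans ?_
    simp
  have hn1 : (1 : ℝ) ≤ n := by exact_mod_cast hn
  have hnε : 1 ≤ (n : ℝ) ^ ε := Real.one_le_rpow hn1 hε.le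
  rcases le_or_gt n₀ n with hle | hlt
  · have hMn : M ^ 2 ≤ (n : ℝ) ^ ε := hn₀ n hle
    set N := (n : ℝ) ^ ε
    have h := measureReal_infDist_le V hM (τ := 128 * N) (by linarith) (by linarith) hX
      (fun j => (hid j).aemeasurable_fst) (fun j => (hid j).map_eq) hσ v
      (1 / 8192 * σ₀ * ρ * Real.sqrt (δ * k))
    refine h.trans ?_
    rw [← one_mul (Real.exp (_ - _))]
    refine mul_le_mul (Real.one_le_exp (Nat.cast_nonneg _)) ?_ (Real.exp_nonneg _)
      (Real.exp_nonneg _)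
    apply Real.exp_le_exp.2
    have hA : σ₀ ^ 2 * (k * ρ ^ 2) ≤ ∑ j, σ j ^ 2 * ‖normalComponent V j‖ ^ 2 := by
      calc _ ≤ σ₀ ^ 2 * ∑ j ∈ G, ‖normalComponent V j‖ ^ 2 := by gcongr
        _ ≤ ∑ j ∈ G, σ j ^ 2 * ‖normalComponent V j‖ ^ 2 := by
            rw [Finset.mul_sum]
            refine Finset.sum_le_sum fun j hj => ?_
            have : σ₀ ≤ σ j := (Finset.mem_filter.1 hj).2
            gcongr
        _ ≤ _ := Finset.sum_le_sum_of_subset_of_nonneg (Finset.subset_univ _)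
            fun _ _ _ => by positivity
    have hsq : (1 / 8192 * σ₀ * ρ * Real.sqrt (δ * k)) ^ 2 =
        (1 / 8192) ^ 2 * (σ₀ ^ 2 * ρ ^ 2 * δ * k) := by
      rw [mul_pow, Real.sq_sqrt (by positivity)]
      ring
    rw [hsq, ← Finset.sum_div]
    set A := ∑ j, σ j ^ 2 * ‖normalComponent V j‖ ^ 2
    have hE0 : 0 ≤ σ₀ ^ 2 * ρ ^ 2 * δ * k := by positivity
    have hEA : σ₀ ^ 2 * ρ ^ 2 * δ * k ≤ A := by
      refine le_trans ?_ hA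
      have : 0 ≤ σ₀ ^ 2 * (k * ρ ^ 2) := by positivity
      nlinarith
    have e : (1 / 8192) ^ 2 * (σ₀ ^ 2 * ρ ^ 2 * δ * k) / (128 * N) - A / (32 * (128 * N)) =
        ((1 / 8192) ^ 2 / 128 * (σ₀ ^ 2 * ρ ^ 2 * δ * k) - A / 4096) / N := by
      field_simp
      ring
    rw [e, ← neg_div]
    apply div_le_div_of_nonneg_right _ (by linarith)
    linarith
  -- For `n < n₀` the exponent is at most `kρ² ≤ n ≤ n₀` in absolute value, so the right side is at
  -- least 1.
  · refine measureReal_le_one.trans ?_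
    rw [← Real.exp_add]
    apply Real.one_le_exp
    have hkn : k * ρ ^ 2 ≤ n := hkG.trans (sum_norm_normalComponent_le V G)
    have hnn : (n : ℝ) ≤ n₀ := by exact_mod_cast hlt.le
    have h1 : 1 / 8192 * σ₀ ^ 2 * ρ ^ 2 * δ * k ≤ n := by
      have h2 : 1 / 8192 * σ₀ ^ 2 * δ ≤ 1 := by nlinarith [sq_nonneg σ₀]
      have h3 : 0 ≤ k * ρ ^ 2 := by positivity
      nlinarith
    have h4 := div_le_self (a := 1 / 8192 * σ₀ ^ 2 * ρ ^ 2 * δ * k) (by positivity) hnε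
    linarith
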